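/- Setting. Let $\pi>0$ be an ordinal. Consider an $\epsilon$-calculus whose expressions $e$ have ranks $rk(e)<\pi+\omega$ (as in the two-sorted theories $\Phi$-FIX, $\Phi\in\{\Pi^0_1,[\Pi^0_1,\Pi^0_1],\Pi^0_2\}$, for non-monotonic inductive definitions, where $\pi$ is the intended closure ordinal). An $\epsilon$-substitution $S$ is a finite function assigning values to canonical expressions, and $rk(S)=\max(\{rk(e):e\in dom(S)\}\cup\{0\})$. Let $Cr$ be a finite sequence of critical formulas and $n(Cr)<\omega$ such that all formulas in $Cr$ have rank below $\mathrm{RANK}:=\pi+n(Cr)$; a substitution is solving if it validates all formulas of $Cr$. Let $S^0,S^1,\dots$ be an H-process for $Cr$: $S^0=\emptyset$; if $S^n$ is solving, then $S^{n+1}=S^n$; if $S^n$ is nonsolving, then for some canonical expression $e$ with $\pi\ne rk(e)<\mathrm{RANK}$ and some value $v$, computed in any way from the process so far, $$S^{n+1}=\{(f,u)\in S^n: rk(f)<rk(e)\}\cup\{(f,u)\in S^n: rk(f)=rk(e),\ f\neq e\}\cup\{(e,v)\}.$$ Put $r_n=rk(S^n)$. For $m<k$ let $\vec S^{m,k}=(S^n)_{m\le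 n<k}$ and $rk(\vec S^{m,k})=\min(\{r_i:m<i<k\}\cup\{\mathrm{RANK}\})$. The series $\vec S^{m,k}$ is a section if $r_m<rk(\vec S^{m,k})$. If $r_m\le rk(\vec S^{m,k})$, let $k_0<\dots<k_l$ enumerate $\{n\in[m,k): r_n\le rk(\vec S^{n,k})\}$ and put $k_{l+1}=k$; the series $\vec S^{k_j,k_{j+1}}$ $(j\le l)$ are the components of $\vec S^{m,k}$ (so $k_0=m$). A $0$-series is a series of length $1$; $\vec S^{m,k}$ with $m<k$ and $r_m\le rk(\vec S^{m,k})$ is a $(p+1)$-series if each of its components is a section and a $p$-series. A $p$-series is normal if its last substitution is nonsolving. If $S^n$ is nonsolving, $M(p,n)$ is the number $k$ such that $\vec S^{n,k}$ is the longest normal $p$-series starting with $S^n$ (read as $0$ if there are arbitrarily long ones); if $S^n$ is solving, $M(0,n)=n+1$ and $M(p+1,n)=n$. Let $\ell_p=M(p+1,0)$. Proposition. Let $p>n(Cr)$ and suppose $\ell_p<\ell_{p+1}$. Then $m_p:=\max\{n<\ell_p: r_n<\pi\}$ exists, and $$\pi>r_{m_p}>r_{\ell_p}.$$ -/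

import Mathlib

open Ordinal

universe u v w

/-- The expressions (terms and formulas, in particular critical formulas) of an epsilon calculus
whose ranks are ordinals below `π + ω`, with the values that epsilon substitutions may assign.
The values of ordinal and of number sort, and truth values, all live in `Val`. -/
structure EpsilonCalculus (π : Ordinal.{w}) where
  /-- closed expressions -/
  Expr : Type u
  /-- values of canonical expressions -/
  Val : Type v
  /-- the canonical expressions, to which a substitution may assign a value -/
  IsCanonical : Expr → Prop
  /-- the rank of an expression -/
  rk : Expr → Ordinal.{w}
  rk_lt : ∀ e, rk e < π + ω
  /-- `Validates s F`: the formula `F` is true under the finite assignment `s` (with default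
  values for the canonical expressions outside the domain of `s`) -/
  Validates : Finset (Expr × Val) → Expr → Prop

namespace EpsilonCalculus

variable {π : Ordinal.{w}}

/-- An epsilon substitution: a finite function from canonical expressions to values,
given by its graph. -/
structure Subst (T : EpsilonCalculus.{u, v, w} π) where
  graph : Finset (T.Expr × T.Val)
  functional : ∀ e a b, (e, a) ∈ graph → (e, b) ∈ graph → a = b
  canonical : ∀ x ∈ graph, T.IsCanonical x.1

/-- `rk(S) = max ({rk e | e ∈ dom S} ∪ {0})`. -/
noncomputable def Subst.rank {T : EpsilonCalculus.{u, v, w} π} (S : T.Subst) : Ordinal.{w} :=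
  S.graph.sup fun x => T.rk x.1

/-- `S` is solving for the finite sequence `Cr` of critical formulas. -/
def Subst.Solves {T : EpsilonCalculus.{u, v, w} π} (S : T.Subst) (Cr : List T.Expr) : Prop :=
  ∀ F ∈ Cr, T.Validates S.graph F

/-- `S'` arises from `S` by correcting the value of `e` to `v`: pairs of rank below `rk e` and the
other pairs of rank `rk e` are kept, pairs of higher rank are forgotten. -/
def Subst.IsUpdate {T : EpsilonCalculus.{u, v, w} π} (S : T.Subst) (e : T.Expr) (v : T.Val)
    (S' : T.Subst) : Prop :=
  (S'.graph : Set (T.Expr × T.Val)) =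
    {x | x ∈ S.graph ∧ T.rk x.1 < T.rk e} ∪
    {x | x ∈ S.graph ∧ T.rk x.1 = T.rk e ∧ x.1 ≠ e} ∪ {(e, v)}

/-- An H-process for `Cr`, with `RANK = π + nCr` exceeding the ranks of the critical formulas:
start with the empty substitution; stop at a solution; otherwise correct the value of one
canonical expression `e`, of rank below `RANK` and different from `π`. The way in which `e` and its
new value are computed is left free: they may depend on the whole process so far. -/
structure EpsilonRun (T : EpsilonCalculus.{u, v, w} π) (Cr : List T.Expr) (nCr : ℕ) where
  /-- the substitution `S^n` -/
  S : ℕ → T.Subst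
  rk_crit : ∀ F ∈ Cr, T.rk F < π + nCr
  start : (S 0).graph = ∅
  halt : ∀ n, (S n).Solves Cr → S (n + 1) = S n
  step : ∀ n, ¬ (S n).Solves Cr →
    ∃ (e : T.Expr) (v : T.Val), T.IsCanonical e ∧ T.rk e < π + nCr ∧ T.rk e ≠ π ∧
      (S n).IsUpdate e v (S (n + 1))

namespace EpsilonRun

variable {T : EpsilonCalculus.{u, v, w} π} {Cr : List T.Expr} {nCr : ℕ}

/-- `r_n = rk(S^n)`. -/
noncomputable def r (P : EpsilonRun T Cr nCr) (n : ℕ) : Ordinal.{w} := (P.S n).rank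

/-- `S^n` is solving. -/
def Solving (P : EpsilonRun T Cr nCr) (n : ℕ) : Prop := (P.S n).Solves Cr

/-- The rank `min ({r_i | m < i < k} ∪ {RANK})` of the series `S^m, …, S^(k-1)`. -/
noncomputable def seriesRank (P : EpsilonRun T Cr nCr) (m k : ℕ) : Ordinal.{w} :=
  sInf (insert (π + nCr) (P.r '' Set.Ioo m k))

/-- The series `S^m, …, S^(k-1)` is a section. -/
def IsSection (P : EpsilonRun T Cr nCr) (m k : ℕ) : Prop := P.r m < P.seriesRank m k

/-- `nd`: the indices in `[m, k)` whose rank is minimal among the ranks from there up to `k`. -/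
def nd (P : EpsilonRun T Cr nCr) (m k : ℕ) : Set ℕ :=
  {n | m ≤ n ∧ n < k ∧ P.r n ≤ P.seriesRank n k}

/-- `[a, b)` is a component in the decomposition of `[m, k)`: `a` is in `nd`, and `b` is the next
element of `nd`, or `k` if `a` is the last one. -/
def IsComponent (P : EpsilonRun T Cr nCr) (m k a b : ℕ) : Prop :=
  a ∈ P.nd m k ∧ IsLeast {b | a < b ∧ (b ∈ P.nd m k ∨ b = k)} b

/-- `S^m, …, S^(k-1)` is a `p`-series. -/
def IsPSeries (P : EpsilonRun T Cr nCr) : ℕ → ℕ → ℕ → Prop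
  | 0, m, k => k = m + 1
  | p + 1, m, k => m < k ∧ P.r m ≤ P.seriesRank m k ∧
      ∀ a b, P.IsComponent m k a b → P.IsSection a b ∧ IsPSeries P p a b

/-- A `p`-series is normal if its last substitution is nonsolving. -/
def IsNormalPSeries (P : EpsilonRun T Cr nCr) (p n k : ℕ) : Prop :=
  P.IsPSeries p n k ∧ ¬ P.Solving (k - 1)

open Classical in
/-- `M(p, n)`: the end `k` of the longest normal `p`-series `S^n, …, S^(k-1)` starting with a
nonsolving `S^n`; if `S^n` is solving, `M(0, n) = n + 1` and `M(p + 1, n) = n`. (The supremum is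
read as `0` if there are arbitrarily long normal `p`-series starting with `S^n`.) -/
noncomputable def M (P : EpsilonRun T Cr nCr) (p n : ℕ) : ℕ :=
  if P.Solving n then (if p = 0 then n + 1 else n) else sSup {k | P.IsNormalPSeries p n k}

/-- `ℓ_p = M(p + 1, 0)`. -/
noncomputable def ell (P : EpsilonRun T Cr nCr) (p : ℕ) : ℕ := P.M (p + 1) 0

end EpsilonRun

end EpsilonCalculus

/-! Since `ℓ_p < ℓ_{p+1}`, the substitution at `ℓ_p` is nonsolving, so by maximality adding it must
destroy the `(p+1)`-series. It is shown that this cannot happen if `r_{m_p} ≤ r_{ℓ_p}`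
(`IsPSeries.append`): every component before the new last one is then an old component or starts at
or after `m_p`. In the latter case its interior ranks lie in `[π, π + nCr)`, hence take at most
`nCr` values, and few interior ranks force a `p`-series (`isPSeries_of_ncard_le`). -/

namespace EpsilonCalculus

variable {π : Ordinal.{w}} {T : EpsilonCalculus.{u, v, w} π}

/-- Correcting the value of `e` produces a substitution of rank `rk e`. -/
theorem Subst.IsUpdate.rank_eq {S S' : T.Subst} {e : T.Expr} {x : T.Val}
    (h : S.IsUpdate e x S') : S'.rank = T.rk e := by
  have key : ∀ y, y ∈ S'.graph ↔ (y ∈ S.graph ∧ T.rk y.1 < T.rk e ∨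
      y ∈ S.graph ∧ T.rk y.1 = T.rk e ∧ y.1 ≠ e) ∨ y = (e, x) := by
    intro y
    have := Set.ext_iff.mp h y
    simpa [or_comm] using this
  apply le_antisymm
  · refine Finset.sup_le fun y hy => ?_
    rcases (key y).1 hy with (⟨_, h1⟩ | ⟨_, h1, _⟩) | rfl
    · exact h1.le
    · exact h1.le
    · exact le_rfl
  · exact Finset.le_sup (f := fun y : T.Expr × T.Val => T.rk y.1) ((key (e, x)).2 (Or.inr rfl))

namespace EpsilonRun

variable {Cr : List T.Expr} {nCr : ℕ} (P : EpsilonRun T Cr nCr)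

theorem r_zero : P.r 0 = 0 := by
  simp [r, Subst.rank, P.start]

theorem r_lt_and_ne (hπ : 0 < π) (n : ℕ) : P.r n < π + nCr ∧ P.r n ≠ π := by
  induction n with
  | zero =>
    rw [P.r_zero]
    exact ⟨hπ.trans_le le_self_add, hπ.ne⟩
  | succ n ih =>
    by_cases hs : (P.S n).Solves Cr
    · rw [r, P.halt n hs]
      exact ih
    · obtain ⟨e, x, -, h1, h2, h3⟩ := P.step n hs
      rw [r, h3.rank_eq]
      exact ⟨h1, h2⟩

theorem not_solving_of_le {m n : ℕ} (hmn : m ≤ n) (hn : ¬ P.Solving n) : ¬ P.Solving m := by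
  intro hm
  apply hn
  induction n, hmn using Nat.le_induction with
  | base => exact hm
  | succ k _ ih =>
    by_cases hk : P.Solving k
    · rw [Solving, P.halt k hk]
      exact hk
    · exact absurd (ih hk) hk

theorem le_seriesRank_iff {o : Ordinal.{w}} {m k : ℕ} :
    o ≤ P.seriesRank m k ↔ o ≤ π + nCr ∧ ∀ i, m < i → i < k → o ≤ P.r i := by
  rw [seriesRank, le_csInf_iff (OrderBot.bddBelow _) (Set.insert_nonempty _ _)]
  simp only [Set.forall_mem_insert, Set.forall_mem_image, Set.mem_Ioo, and_imp]

theorem lt_seriesRank_iff {o : Ordinal.{w}} {m k : ℕ} :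
    o < P.seriesRank m k ↔ o < π + nCr ∧ ∀ i, m < i → i < k → o < P.r i := by
  simp only [← Order.succ_le_iff, le_seriesRank_iff]

theorem r_le_seriesRank_iff (hπ : 0 < π) {m k : ℕ} :
    P.r m ≤ P.seriesRank m k ↔ ∀ i, m < i → i < k → P.r m ≤ P.r i := by
  rw [le_seriesRank_iff, and_iff_right (P.r_lt_and_ne hπ m).1.le]

theorem isSection_iff (hπ : 0 < π) {m k : ℕ} :
    P.IsSection m k ↔ ∀ i, m < i → i < k → P.r m < P.r i := by
  rw [IsSection, lt_seriesRank_iff, and_iff_right (P.r_lt_and_ne hπ m).1]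

theorem mem_nd_iff (hπ : 0 < π) {m k n : ℕ} :
    n ∈ P.nd m k ↔ m ≤ n ∧ n < k ∧ ∀ i, n < i → i < k → P.r n ≤ P.r i := by
  rw [nd, Set.mem_ofPred_eq, P.r_le_seriesRank_iff hπ]

variable {P}

/-- Every component is a section. -/
theorem IsComponent.isSection (hπ : 0 < π) {m k a b : ℕ} (h : P.IsComponent m k a b) :
    P.IsSection a b := by
  obtain ⟨ha, -, hleast⟩ := h
  rw [P.mem_nd_iff hπ] at ha
  obtain ⟨hma, hak, hmin⟩ := ha
  have hbk : b ≤ k := hleast ⟨hak, Or.inr rfl⟩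
  rw [P.isSection_iff hπ]
  -- An interior index of rank at most `r a` would inherit the minimality of `a` and start a
  -- component before `b`.
  intro i hai hib
  by_contra! hle
  refine hib.not_ge (hleast ⟨hai, Or.inl ?_⟩)
  rw [P.mem_nd_iff hπ]
  exact ⟨by lia, by lia, fun j hij hjk => hle.trans (hmin j (by lia) hjk)⟩

/-- The ranks inside a component that is not the last one exceed the rank of the next
component. -/
theorem IsComponent.r_lt (hπ : 0 < π) {m k a b i : ℕ} (h : P.IsComponent m k a b)
    (hai : a < i) (hib : i < b) : b < k ∧ P.r b < P.r i := by
  obtain ⟨ha, ⟨-, hb⟩, hleast⟩ := h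
  rw [P.mem_nd_iff hπ] at ha
  have hbk : b ≤ k := hleast ⟨ha.2.1, Or.inr rfl⟩
  -- If `b` were `k`, the index `b - 1` would be vacuously minimal and start a component inside `(a,
  -- b)`.
  have hend : ∃ j, a < j ∧ j < b ∧ ∀ l, j < l → l < b → P.r j ≤ P.r l :=
    ⟨b - 1, by lia, by lia, fun l _ _ => by lia⟩
  have hnot : ∀ j, a < j → j < b → ¬ ∀ l, j < l → l < k → P.r j ≤ P.r l := by
    intro j haj hjb hj
    refine hjb.not_ge (hleast ⟨haj, Or.inl ?_⟩)
    rw [P.mem_nd_iff hπ]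
    exact ⟨by lia, by lia, hj⟩
  have hbk' : b < k := by
    refine hbk.lt_of_ne ?_
    rintro rfl
    obtain ⟨j, h1, h2, h3⟩ := hend
    exact hnot j h1 h2 h3
  refine ⟨hbk', ?_⟩
  have hbnd := hb.resolve_right hbk'.ne
  rw [P.mem_nd_iff hπ] at hbnd
  by_contra! hle
  obtain ⟨j, hj, hjmin⟩ := (Finset.Ioo a b).exists_minimalFor P.r ⟨i, by simp; lia⟩
  rw [Finset.mem_Ioo] at hj
  have hmin : ∀ l, a < l → l < b → P.r j ≤ P.r l := by
    intro l h1 h2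
    rcases le_total (P.r j) (P.r l) with h3 | h3
    · exact h3
    · exact hjmin (Finset.mem_Ioo.2 ⟨h1, h2⟩) h3
  refine hnot j hj.1 hj.2 fun l hjl hlk => ?_
  rcases lt_trichotomy l b with h1 | rfl | h1
  · exact hmin l (by lia) h1
  · exact (hmin i hai hib).trans hle
  · exact ((hmin i hai hib).trans hle).trans (hbnd.2.2 l h1 hlk)

/-- A series with head of minimal rank, whose other ranks take at most `p` values, is a
`p`-series. -/
theorem isPSeries_of_ncard_le (hπ : 0 < π) {p a b : ℕ} (hab : a < b)
    (hmin : ∀ i, a < i → i < b → P.r a ≤ P.r i)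
    (hcard : (P.r '' Set.Ioo a b).ncard ≤ p) : P.IsPSeries p a b := by
  induction p generalizing a b with
  | zero =>
    have h0 : (P.r '' Set.Ioo a b) = ∅ := by
      rwa [Nat.le_zero, Set.ncard_eq_zero ((Set.finite_Ioo a b).image _)] at hcard
    rw [Set.image_eq_empty] at h0
    rw [IsPSeries]
    by_contra hne
    have : a + 1 ∈ Set.Ioo a b := ⟨by lia, by lia⟩
    simp [h0] at this
  | succ p ih =>
    refine ⟨hab, (P.r_le_seriesRank_iff hπ).2 hmin, fun c d hcd => ?_⟩
    refine ⟨hcd.isSection hπ, ?_⟩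
    have hc := (P.mem_nd_iff hπ).1 hcd.1
    have hcd' : c < d := hcd.2.1.1
    have hdb : d ≤ b := hcd.2.2 ⟨hc.2.1, Or.inr rfl⟩
    refine ih hcd' (fun i h1 h2 => hc.2.2 i h1 (by lia)) ?_
    by_cases hlast : d = c + 1
    · have : Set.Ioo c d = ∅ := by
        ext i
        simp
        lia
      simp [this]
    · have hd := (hcd.r_lt hπ (i := c + 1) (by lia) (by lia)).1
      refine Nat.le_of_lt_succ (lt_of_lt_of_le (Set.ncard_lt_ncard ?_
        ((Set.finite_Ioo a b).image _)) hcard)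
      -- The rank of the next head `d` is a value that the interior of `[c, d)` loses.
      refine (Set.ssubset_iff_of_subset ?_).2 ⟨P.r d, ⟨d, ⟨by lia, hd⟩, rfl⟩, ?_⟩
      · exact Set.image_mono (Set.Ioo_subset_Ioo hc.1 hdb)
      · rintro ⟨i, hi, hid⟩
        exact (hcd.r_lt hπ hi.1 hi.2).2.ne' hid

/-- Transfers boundedness of the normal series from level `p + 2` to level `p + 1` in the main
theorem. -/
theorem IsPSeries.succ (hπ : 0 < π) {p a b : ℕ} (h : P.IsPSeries p a b) :
    P.IsPSeries (p + 1) a b := by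
  induction p generalizing a b with
  | zero =>
    rw [IsPSeries] at h
    subst h
    have : Set.Ioo a (a + 1) = ∅ := by
      ext i
      simp
    exact isPSeries_of_ncard_le hπ (by lia) (fun i _ _ => by lia) (by simp [this])
  | succ p ih =>
    exact ⟨h.1, h.2.1, fun c d hcd => ⟨(h.2.2 c d hcd).1, ih (h.2.2 c d hcd).2⟩⟩

/-- Ranks in `[π, π + nCr)` have the form `π + i` with `i < nCr`. -/
theorem ncard_image_Ioo_le (hπ : 0 < π) {a b : ℕ} (h : ∀ i, a < i → i < b → π ≤ P.r i) :
    (P.r '' Set.Ioo a b).ncard ≤ nCr := by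
  have hsub : P.r '' Set.Ioo a b ⊆
      ((Finset.range nCr).image fun i : ℕ => π + (i : Ordinal.{w}) : Finset Ordinal.{w}) := by
    rintro _ ⟨i, hi, rfl⟩
    have h1 := (P.r_lt_and_ne hπ i).1
    rw [← Ordinal.add_sub_cancel_of_le (h i hi.1 hi.2), add_lt_add_iff_left] at h1
    obtain ⟨n, hn⟩ := Ordinal.lt_omega0.1 (h1.trans (Ordinal.natCast_lt_omega0 nCr))
    rw [hn, Nat.cast_lt] at h1
    rw [Finset.mem_coe, Finset.mem_image]
    exact ⟨n, Finset.mem_range.2 h1, by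
      rw [← hn, Ordinal.add_sub_cancel_of_le (h i hi.1 hi.2)]⟩
  calc _ ≤ _ := Set.ncard_le_ncard hsub (Finset.finite_toSet _)
    _ = _ := Set.ncard_coe_finset _
    _ ≤ _ := Finset.card_image_le
    _ = nCr := Finset.card_range _

/-- A `(p + 1)`-series can be prolonged by a substitution whose rank is at least that of the last
substitution of rank below `π`. -/
theorem IsPSeries.append (hπ : 0 < π) {p m k n : ℕ} (hp : nCr ≤ p)
    (h : P.IsPSeries (p + 1) m k) (hmk : P.r m ≤ P.r k) (hmn : m ≤ n) (hnk : n < k)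
    (hn : P.r n < π) (hlast : ∀ i, n < i → i < k → π ≤ P.r i) (hle : P.r n ≤ P.r k) :
    P.IsPSeries (p + 1) m (k + 1) := by
  obtain ⟨hlt, hmin, hcomp⟩ := h
  rw [P.r_le_seriesRank_iff hπ] at hmin
  refine ⟨by lia, (P.r_le_seriesRank_iff hπ).2 fun i h1 h2 => ?_,
    fun a b hab => ⟨hab.isSection hπ, ?_⟩⟩
  · rcases Nat.lt_succ_iff_lt_or_eq.1 h2 with h3 | rfl
    · exact hmin i h1 h3
    · exact hmk
  have ha := (P.mem_nd_iff hπ).1 hab.1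
  obtain ⟨-, ⟨hab', hb⟩, hleast⟩ := hab
  rcases Nat.lt_succ_iff_lt_or_eq.1 ha.2.1 with hak | rfl
  -- The last index `k` of the longer series always starts a component.
  · have hbk : b ≤ k := hleast ⟨hak, Or.inl ((P.mem_nd_iff hπ).2
      ⟨by lia, by lia, fun i _ _ => by lia⟩)⟩
    have hand : a ∈ P.nd m k :=
      (P.mem_nd_iff hπ).2 ⟨ha.1, hak, fun i h1 h2 => ha.2.2 i h1 (by lia)⟩
    rcases hbk.lt_or_eq with hbk | rfl
    · have hbnd := (P.mem_nd_iff hπ).1 (hb.resolve_right (by lia))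
      refine (hcomp a b ⟨hand, ⟨hab', Or.inl ((P.mem_nd_iff hπ).2
        ⟨hbnd.1, hbk, fun i h1 h2 => hbnd.2.2 i h1 (by lia)⟩)⟩, ?_⟩).2
      rintro c ⟨hac, hc | rfl⟩
      · by_contra! hcb
        rw [P.mem_nd_iff hπ] at hc
        refine hcb.not_ge (hleast ⟨hac, Or.inl ((P.mem_nd_iff hπ).2
          ⟨hc.1, by lia, fun i h1 h2 => ?_⟩)⟩)
        rcases Nat.lt_succ_iff_lt_or_eq.1 h2 with h3 | rfl
        · exact hc.2.2 i h1 h3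
        -- Minimality of `c` extends to the new index through `r c ≤ r b ≤ r k`.
        · exact (hc.2.2 b hcb hbk).trans (hbnd.2.2 _ hbk (by lia))
      · exact hbk.le
    -- Here `[a, k)` may fuse several old components, but `n` still starts a component, so `a`
    -- cannot precede it.
    · have hna : n ≤ a := by
        by_contra! han
        refine hnk.not_ge (hleast ⟨han, Or.inl ((P.mem_nd_iff hπ).2
          ⟨hmn, by lia, fun i h1 h2 => ?_⟩)⟩)
        rcases Nat.lt_succ_iff_lt_or_eq.1 h2 with h3 | rfl
        · exact hn.le.trans (hlast i h1 h3)
        · exact hle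
      exact isPSeries_of_ncard_le hπ hab' (fun i h1 h2 => ha.2.2 i h1 (by lia))
        ((ncard_image_Ioo_le hπ fun i h1 h2 => hlast i (by lia) h2).trans hp)
  · have hb' : b = a + 1 := le_antisymm (hleast ⟨by lia, Or.inr rfl⟩) hab'
    exact isPSeries_of_ncard_le hπ hab' (fun i _ _ => by lia)
      ((ncard_image_Ioo_le hπ fun i _ _ => by lia).trans hp)

end EpsilonRun

end EpsilonCalculus

open EpsilonCalculus.EpsilonRun in
theorem mainTheorem6 (π : Ordinal.{w}) (hπ : 0 < π)
    (T : EpsilonCalculus.{u, v, w} π) (Cr : List T.Expr) (nCr : ℕ)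
    (P : EpsilonCalculus.EpsilonRun T Cr nCr) (p : ℕ) (hp : nCr < p)
    (hell : P.ell p < P.ell (p + 1)) :
    ∃ m : ℕ, IsGreatest {n | n < P.ell p ∧ P.r n < π} m ∧
      P.r m < π ∧ P.r (P.ell p) < P.r m := by
  have h0 : ¬ P.Solving 0 := by
    intro h0
    simp [ell, M, h0] at hell
  have hdef : ∀ q, P.ell q = sSup {k | P.IsNormalPSeries (q + 1) 0 k} := by
    intro q
    simp [ell, M, h0]
  -- Unboundedness would give `ℓ_{p+1}` the default value `0`, which exceeds nothing.
  have hbdd' : BddAbove {k | P.IsNormalPSeries (p + 1 + 1) 0 k} := by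
    by_contra hb
    rw [hdef (p + 1), Nat.sSup_of_not_bddAbove hb] at hell
    exact absurd hell (Nat.not_lt_zero _)
  have hsub : {k | P.IsNormalPSeries (p + 1) 0 k} ⊆ {k | P.IsNormalPSeries (p + 1 + 1) 0 k} :=
    fun k hk => ⟨hk.1.succ hπ, hk.2⟩
  have hne : {k | P.IsNormalPSeries (p + 1) 0 k}.Nonempty :=
    ⟨1, isPSeries_of_ncard_le hπ one_pos (fun i _ _ => by lia)
      ((ncard_image_Ioo_le hπ fun i _ _ => by lia).trans (by lia)), h0⟩
  have hbdd := hbdd'.mono hsub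
  have hL : P.IsNormalPSeries (p + 1) 0 (P.ell p) := hdef p ▸ Nat.sSup_mem hne hbdd
  have hK : P.IsNormalPSeries (p + 1 + 1) 0 (P.ell (p + 1)) :=
    hdef (p + 1) ▸ Nat.sSup_mem (hne.mono hsub) hbdd'
  -- The index `ℓ_p` is at most `ℓ_{p+1} - 1`, where the process is still nonsolving.
  have hLns : ¬ P.Solving (P.ell p) := P.not_solving_of_le (by lia) hK.2
  have hmax : ¬ P.IsPSeries (p + 1) 0 (P.ell p + 1) := by
    intro h
    have : P.ell p + 1 ≤ P.ell p := by
      conv_rhs => rw [hdef p]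
      exact le_csSup hbdd ⟨h, hLns⟩
    lia
  have hr0 : P.r 0 < π := by rwa [P.r_zero]
  have hfin : BddAbove {n | n < P.ell p ∧ P.r n < π} := ⟨P.ell p, fun n hn => hn.1.le⟩
  obtain ⟨hm1, hm2⟩ := Nat.sSup_mem (s := {n | n < P.ell p ∧ P.r n < π}) ⟨0, hL.1.1, hr0⟩ hfin
  refine ⟨_, ⟨⟨hm1, hm2⟩, fun n hn => le_csSup hfin hn⟩, hm2, ?_⟩
  by_contra! hle
  refine hmax (hL.1.append hπ hp.le ?_ (Nat.zero_le _) hm1 hm2 (fun i h1 h2 => ?_) hle)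
  · rw [P.r_zero]
    exact zero_le
  · by_contra! h3
    exact h1.not_ge (le_csSup hfin ⟨h2, h3⟩)
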